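/- **Setting.** Let $d\ge 1$, $\alpha>0$, $s>0$, and put $\delta=d/\alpha$ and $c_d=\pi^{d/2}/\Gamma(1+d/2)$ (the volume of the unit ball of $\mathbb R^d$). Let $y_1,y_2,\dots$ be the points of a homogeneous Poisson point process of intensity $1$ in $\mathbb{R}^d$ (the nodes), ordered by their Euclidean distance to the origin. Let $f,f_1,f_2,\dots$ be iid nonnegative random variables (the fading coefficients), independent of the nodes, with $\mathbb{E}f=1$ and distribution function $F(t)=\mathbb{P}(f\le t)$. Let $x_i=\|y_i\|^\alpha$ be the path loss of node $i$ before fading and $\xi_i=x_i/f_i$ its path loss with fading ($\xi_i=\infty$ if $f_i=0$). Node $i$ is *connected* to the origin if $\xi_i<1/s$. Let $\Phi=\{x_i\}$, $\hat\Phi=\{x_i:\xi_i<1/s\}$, and let $\hat N=\hat\Phi([0,\infty))$ be the number of connected nodes. A point process on $\mathbb R$ has density $\lambda$ if its expected number of points in each Borel set $B$ is $\int_B\lambda(x)\,dx$. **Proposition (Connectivity).** (a) $\Phi$ has a density $\lambda$, namely $\lambda(x)=c_d\,\delta\, x^{\delta-1}$ for $x>0$ and $\lambda(x)=0$ for $x\le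 0$. The process $\hat\Phi$ is a Poisson point process with density $$\hat\lambda(x)=\lambda(x)\,\bigl(1-F(sx)\bigr).$$ (b) Let $m>0$ and suppose that the fading is Nakagami-$m$, i.e. $f$ has probability density $m^m t^{m-1}e^{-mt}/\Gamma(m)$ on $(0,\infty)$. Then $\hat N$ is Poisson distributed with mean $$\mathbb{E}\hat N_m=\frac{c_d}{(ms)^{\delta}}\,\frac{\Gamma(\delta+m)}{\Gamma(m)},$$ and the connectivity fading gain, i.e. the ratio of $\mathbb{E}\hat N_m$ to the expected number $\mathbb{E}\hat N_\infty$ of connected nodes without fading (all $f_i=1$), is $$\frac{\mathbb{E}\hat N_m}{\mathbb{E}\hat N_\infty}=\frac1{m^{\delta}}\,\frac{\Gamma(\delta+m)}{\Gamma(m)}=\mathbb{E}(f^{\delta}).$$ -/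

import Mathlib

open MeasureTheory ProbabilityTheory
open scoped ENNReal

/-- The Poisson distribution with mean `r ∈ [0, ∞]`, as a measure on `[0, ∞]`; for `r = ∞` it is
the unit mass at `∞`. -/
noncomputable def poissonLaw (r : ℝ≥0∞) : Measure ℝ≥0∞ :=
  open Classical in
  if r = ∞ then Measure.dirac ∞ else (poissonMeasure r.toNNReal).map (Nat.cast : ℕ → ℝ≥0∞)

/-- The random measure `N` is a Poisson point process with intensity measure `Λ`. -/
structure IsPoissonProcess {Ω E : Type*} [MeasurableSpace Ω] [MeasurableSpace E]
    (P : Measure Ω) (N : Ω → Measure E) (Λ : Measure E) : Prop where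
  measurable : Measurable N
  hasLaw : ∀ B : Set E, MeasurableSet B → HasLaw (fun ω => N ω B) (poissonLaw (Λ B)) P
  indep : ∀ (n : ℕ) (B : Fin n → Set E), (∀ k, MeasurableSet (B k)) →
    Pairwise (fun j k => Disjoint (B j) (B k)) → iIndepFun (fun k ω => N ω (B k)) P

/-- The point process `N` on the line has density `l`: the expected number of points in a Borel
set `B` is `∫_B l(x) dx`. -/
def HasDensity {Ω : Type*} [MeasurableSpace Ω]
    (P : Measure Ω) (N : Ω → Measure ℝ) (l : ℝ → ℝ≥0∞) : Prop :=
  Measurable l ∧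
    ∀ B : Set ℝ, MeasurableSet B → ∫⁻ ω, N ω B ∂P = ∫⁻ x in B, l x

/-- The counting measure of the random points `x 0, x 1, …`. -/
noncomputable def pointProcess {Ω E : Type*} [MeasurableSpace E]
    (x : ℕ → Ω → E) (ω : Ω) : Measure E :=
  Measure.sum fun i => Measure.dirac (x i ω)

/-- The volume of the unit ball in dimension `d`. -/
noncomputable def unitBallVolume (d : ℕ) : ℝ :=
  Real.pi ^ ((d : ℝ) / 2) / Real.Gamma (1 + (d : ℝ) / 2)

/-- The nodes `y 0, y 1, …` are the points of a Poisson process of intensity `1` in `ℝ^d`, ordered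
by their distance to the origin; the fading coefficients `f 0, f 1, …` are iid with distribution
`ν`, which lives on `[0, ∞)` and has mean one, and they are independent of the nodes. -/
structure IsFadingNetwork {Ω : Type*} [MeasurableSpace Ω] (P : Measure Ω) (d : ℕ)
    (y : ℕ → Ω → EuclideanSpace ℝ (Fin d)) (f : ℕ → Ω → ℝ) (ν : Measure ℝ) : Prop where
  measurable_node : ∀ i, Measurable (y i)
  poisson_node : IsPoissonProcess P (pointProcess y) volume
  ordered : ∀ᵐ ω ∂P, Monotone fun i => ‖y i ω‖
  measurable_fading : ∀ i, Measurable (f i)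
  law_fading : ∀ i, HasLaw (f i) ν P
  indep_fading : iIndepFun f P
  indep_node_fading : IndepFun (fun ω i => y i ω) (fun ω i => f i ω) P
  fading_nonneg : ν (Set.Iio 0) = 0
  fading_mean : ∫ t, t ∂ν = 1

section Network

variable {Ω : Type*} {d : ℕ}

/-- Path loss of node `i` before fading. -/
noncomputable def pathLoss (α : ℝ) (y : ℕ → Ω → EuclideanSpace ℝ (Fin d)) (i : ℕ) (ω : Ω) : ℝ :=
  ‖y i ω‖ ^ α

/-- Path loss of node `i` with fading, in `[0, ∞]`: it is `∞` if the fading coefficient is `0`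
(and the node is not at the origin). -/
noncomputable def fadedPathLoss (α : ℝ) (y : ℕ → Ω → EuclideanSpace ℝ (Fin d))
    (f : ℕ → Ω → ℝ) (i : ℕ) (ω : Ω) : ℝ≥0∞ :=
  ENNReal.ofReal (pathLoss α y i ω) / ENNReal.ofReal (f i ω)

/-- Counting measure of the path losses before fading of the connected nodes, that is, of those
nodes whose path loss with fading is smaller than `1 / s`. -/
noncomputable def connectedProcess (α s : ℝ) (y : ℕ → Ω → EuclideanSpace ℝ (Fin d))
    (f : ℕ → Ω → ℝ) (ω : Ω) : Measure ℝ :=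
  Measure.sum fun i : {i : ℕ // fadedPathLoss α y f i ω < ENNReal.ofReal (1 / s)} =>
    Measure.dirac (pathLoss α y i ω)

/-- The number of connected nodes. -/
noncomputable def connectedCount (α s : ℝ) (y : ℕ → Ω → EuclideanSpace ℝ (Fin d))
    (f : ℕ → Ω → ℝ) (ω : Ω) : ℝ≥0∞ :=
  connectedProcess α s y f ω (Set.Ici 0)

/-- The ratio of the expected numbers of connected nodes with fading and without fading (all
fading coefficients equal to `1`). -/
noncomputable def connectivityFadingGain [MeasurableSpace Ω] (P : Measure Ω) (α s : ℝ)
    (y : ℕ → Ω → EuclideanSpace ℝ (Fin d)) (f : ℕ → Ω → ℝ) : ℝ≥0∞ :=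
  (∫⁻ ω, connectedCount α s y f ω ∂P) / ∫⁻ ω, connectedCount α s y (fun _ _ => 1) ω ∂P

end Network

/-- The density `c_d δ x^(δ - 1)`, `δ = d / α`, on `(0, ∞)`. -/
noncomputable def pathLossDensity (d : ℕ) (α : ℝ) (x : ℝ) : ℝ≥0∞ :=
  if 0 < x then ENNReal.ofReal (unitBallVolume d * (d / α) * x ^ ((d : ℝ) / α - 1)) else 0

/-! Attach to each node its fading coefficient. By the marking theorem the pairs `(y i, f i)` form a
Poisson process on `ℝ^d × ℝ` with intensity `volume × ν`. Whether a node is connected depends only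
on its pair, so `connectedProcess` is this process restricted to `connectedRegion` and pushed
forward by `‖z‖ ^ α`, and both operations preserve Poisson processes. Its intensity follows by
Fubini, in either order. Over a location `z ≠ 0` the fibre is `t > s * ‖z‖ ^ α`, of mass `1 - F(s *
‖z‖ ^ α)`; this gives the density. Over `t > 0` the fibre is a ball of volume `c_d (t / s) ^ δ`, so
the mean count is `c_d s ^ (-δ) 𝔼(f ^ δ)`. The fading gain is therefore a fractional moment, which
is explicit for gamma laws. Marking rests on the Laplace functional `𝔼 exp(-∫ g dN) = exp(-∫ (1 -
exp(-g)) dΛ)`, which characterises Poisson processes. Given the nodes, averaging over the marks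
replaces `exp(-g(z, t))` by its `ν`-mean `u z`, and the functional of the unmarked process is then
applied to `-log u`. Working in `[0, ∞]` throughout avoids integrability conditions. -/

/-! ### Exponential and logarithm on `[0, ∞]` -/

namespace ENNReal

/-- The function `x ↦ exp (-x)` on `[0, ∞]`. -/
noncomputable def expNeg (x : ℝ≥0∞) : ℝ≥0∞ := EReal.exp (-(x : EReal))

@[simp] lemma expNeg_zero : expNeg 0 = 1 := by simp [expNeg]

lemma expNeg_add (x y : ℝ≥0∞) : expNeg (x + y) = expNeg x * expNeg y := by
  rw [expNeg, EReal.coe_ennreal_add, EReal.neg_add, sub_eq_add_neg, EReal.exp_add, expNeg, expNeg]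
  · left; simp
  · right; simp

lemma expNeg_sum {ι : Type*} (s : Finset ι) (x : ι → ℝ≥0∞) :
    expNeg (∑ i ∈ s, x i) = ∏ i ∈ s, expNeg (x i) := by
  classical
  induction s using Finset.induction_on with
  | empty => simp
  | insert a s ha ih => rw [Finset.sum_insert ha, Finset.prod_insert ha, expNeg_add, ih]

lemma expNeg_natCast_mul (n : ℕ) (x : ℝ≥0∞) : expNeg (n * x) = expNeg x ^ n := by
  simpa using expNeg_sum (Finset.range n) fun _ => x

lemma expNeg_ofReal {r : ℝ} (hr : 0 ≤ r) :
    expNeg (ENNReal.ofReal r) = ENNReal.ofReal (Real.exp (-r)) := by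
  rw [expNeg, EReal.coe_ennreal_ofReal, max_eq_left hr, ← EReal.coe_neg, EReal.exp_coe]

@[fun_prop] lemma continuous_expNeg : Continuous expNeg :=
  ENNReal.continuous_exp.comp (continuous_neg.comp continuous_coe_ennreal_ereal)

@[fun_prop] lemma measurable_expNeg : Measurable expNeg := continuous_expNeg.measurable

lemma expNeg_injective : Function.Injective expNeg := fun x y h => by
  simpa using EReal.exp_strictMono.injective h

lemma expNeg_le_one (x : ℝ≥0∞) : expNeg x ≤ 1 := by
  simp [expNeg, EReal.coe_ennreal_nonneg]

lemma expNeg_ne_top (x : ℝ≥0∞) : expNeg x ≠ ∞ :=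
  ((expNeg_le_one x).trans_lt one_lt_top).ne

lemma expNeg_lt_one {x : ℝ≥0∞} (hx : x ≠ 0) : expNeg x < 1 := by
  refine lt_of_le_of_ne (expNeg_le_one x) fun h => hx (expNeg_injective ?_)
  rw [h, expNeg_zero]

/-- The function `u ↦ -log u` on `[0, ∞]`, truncated at `0`. -/
noncomputable def negLog (u : ℝ≥0∞) : ℝ≥0∞ := (-(ENNReal.log u)).toENNReal

@[fun_prop] lemma measurable_negLog : Measurable negLog :=
  (continuous_neg.measurable.comp ENNReal.measurable_log).ereal_toENNReal

lemma expNeg_negLog {u : ℝ≥0∞} (hu : u ≤ 1) : expNeg (negLog u) = u := by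
  rw [expNeg, negLog, EReal.coe_toENNReal, neg_neg, ENNReal.exp_log]
  simpa [EReal.le_neg] using hu

lemma expNeg_tsum_tendsto (x : ℕ → ℝ≥0∞) :
    Filter.Tendsto (fun n => ∏ i ∈ Finset.range n, expNeg (x i)) Filter.atTop
      (nhds (expNeg (∑' i, x i))) := by
  simp_rw [← expNeg_sum]
  exact (continuous_expNeg.tendsto _).comp (ENNReal.tendsto_nat_tsum x)

end ENNReal

open ENNReal

/-! ### Poisson laws and their Laplace transforms -/

instance isProbabilityMeasure_poissonLaw (r : ℝ≥0∞) : IsProbabilityMeasure (poissonLaw r) := by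
  unfold poissonLaw
  split_ifs
  · infer_instance
  · exact Measure.isProbabilityMeasure_map Measurable.of_discrete.aemeasurable

lemma lintegral_poissonLaw_of_ne_top {r : ℝ≥0∞} (hr : r ≠ ∞) {g : ℝ≥0∞ → ℝ≥0∞}
    (hg : Measurable g) :
    ∫⁻ x, g x ∂poissonLaw r =
      ∑' n : ℕ, ENNReal.ofReal (Real.exp (-r.toReal) * r.toReal ^ n / n.factorial) * g n := by
  rw [poissonLaw, if_neg hr, lintegral_map hg Measurable.of_discrete, poissonMeasure,
    lintegral_sum_measure]
  simp [ENNReal.toReal]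

lemma lintegral_expNeg_poissonLaw (r c : ℝ≥0∞) :
    ∫⁻ x, expNeg (c * x) ∂poissonLaw r = expNeg ((1 - expNeg c) * r) := by
  have hm : Measurable fun x : ℝ≥0∞ => expNeg (c * x) := by fun_prop
  by_cases hr : r = ∞
  · subst hr
    rw [poissonLaw, if_pos rfl, lintegral_dirac' _ hm]
    -- Both sides are `1` for `c = 0`, as `0 * ∞ = 0`, and `0` otherwise.
    by_cases hc : c = 0
    · simp [hc]
    · have : 1 - expNeg c ≠ 0 := (tsub_pos_of_lt (expNeg_lt_one hc)).ne'
      rw [ENNReal.mul_top hc, ENNReal.mul_top this]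
  · rw [lintegral_poissonLaw_of_ne_top hr hm]
    obtain ⟨u, hu⟩ : ∃ u : ℝ, u = (expNeg c).toReal := ⟨_, rfl⟩
    have hu0 : 0 ≤ u := hu ▸ ENNReal.toReal_nonneg
    have hu1 : u ≤ 1 := by
      rw [hu]; exact ENNReal.toReal_le_of_le_ofReal zero_le_one (by simpa using expNeg_le_one c)
    have hcu : expNeg c = ENNReal.ofReal u := by rw [hu, ENNReal.ofReal_toReal (expNeg_ne_top c)]
    obtain ⟨q, hq⟩ : ∃ q : ℝ, q = r.toReal := ⟨_, rfl⟩
    have hq0 : 0 ≤ q := hq ▸ ENNReal.toReal_nonneg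
    have hrq : r = ENNReal.ofReal q := by rw [hq, ENNReal.ofReal_toReal hr]
    have h1 : ∀ n : ℕ, ENNReal.ofReal (Real.exp (-q) * q ^ n / n.factorial) * expNeg (c * n) =
        ENNReal.ofReal (Real.exp (-q) * ((q * u) ^ n / n.factorial)) := fun n => by
      rw [mul_comm c, expNeg_natCast_mul, hcu, ← ENNReal.ofReal_pow hu0, ← ENNReal.ofReal_mul
        (by positivity), mul_pow]
      congr 1; ring
    have h2 : HasSum (fun n : ℕ => Real.exp (-q) * ((q * u) ^ n / n.factorial))
        (Real.exp (-q) * Real.exp (q * u)) := by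
      rw [Real.exp_eq_exp_ℝ]
      exact (NormedSpace.expSeries_div_hasSum_exp (q * u)).mul_left _
    rw [← hq]
    simp_rw [h1]
    rw [← ENNReal.ofReal_tsum_of_nonneg (fun n => by positivity) h2.summable, h2.tsum_eq, hcu,
      hrq, ← ENNReal.ofReal_one, ← ENNReal.ofReal_sub _ hu0,
      ← ENNReal.ofReal_mul (sub_nonneg.2 hu1), expNeg_ofReal (mul_nonneg (sub_nonneg.2 hu1) hq0),
      ← Real.exp_add]
    congr 2; ring

lemma lintegral_id_poissonLaw (r : ℝ≥0∞) : ∫⁻ x, x ∂poissonLaw r = r := by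
  by_cases hr : r = ∞
  · subst hr
    rw [poissonLaw, if_pos rfl, lintegral_dirac' _ measurable_id']
  · rw [lintegral_poissonLaw_of_ne_top hr measurable_id', tsum_eq_zero_add' ENNReal.summable]
    have hq0 : 0 ≤ r.toReal := ENNReal.toReal_nonneg
    have h1 : ∀ n : ℕ, ENNReal.ofReal
        (Real.exp (-r.toReal) * r.toReal ^ (n + 1) / (n + 1).factorial) * ((n + 1 : ℕ) : ℝ≥0∞) =
        r * ENNReal.ofReal (Real.exp (-r.toReal) * r.toReal ^ n / n.factorial) := fun n => by
      conv_rhs => rw [← ENNReal.ofReal_toReal hr]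
      rw [← ENNReal.ofReal_natCast, ← ENNReal.ofReal_mul (by positivity),
        ← ENNReal.ofReal_mul (by positivity), ENNReal.toReal_ofReal hq0, Nat.factorial_succ]
      congr 1
      push_cast
      field_simp
      ring
    simp_rw [h1]
    rw [ENNReal.tsum_mul_left]
    have h2 := lintegral_poissonLaw_of_ne_top hr (measurable_const (a := (1 : ℝ≥0∞)))
    simp only [lintegral_const, measure_univ, mul_one] at h2
    simp [← h2]

/-- Stone–Weierstrass: these exponentials are closed under products and separate points, including
points with infinite coordinates, so integer exponents suffice. -/
lemma ext_of_lintegral_expNeg {ι : Type*} [Fintype ι] {μ μ' : Measure (ι → ℝ≥0∞)}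
    [IsFiniteMeasure μ] [IsFiniteMeasure μ']
    (h : ∀ n : ι → ℕ,
      ∫⁻ x, expNeg (∑ i, n i * x i) ∂μ = ∫⁻ x, expNeg (∑ i, n i * x i) ∂μ') : μ = μ' := by
  classical
  have hc : ∀ n : ι → ℕ, Continuous fun x : ι → ℝ≥0∞ => expNeg (∑ i, n i * x i) := fun n => by
    refine continuous_expNeg.comp (continuous_finsetSum _ fun i _ => ?_)
    exact (ENNReal.continuous_const_mul (by simp)).comp (continuous_apply i)
  have hcr : ∀ n : ι → ℕ, Continuous fun x : ι → ℝ≥0∞ => (expNeg (∑ i, n i * x i)).toReal :=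
    fun n => ENNReal.continuousOn_toReal.comp_continuous (hc n) fun x => expNeg_ne_top _
  let e : (ι → ℕ) → BoundedContinuousFunction (ι → ℝ≥0∞) ℝ := fun n =>
    BoundedContinuousFunction.mkOfCompact ⟨_, hcr n⟩
  have he : ∀ n x, e n x = (expNeg (∑ i, n i * x i)).toReal := fun n x => rfl
  let A : StarSubalgebra ℝ (BoundedContinuousFunction (ι → ℝ≥0∞) ℝ) :=
    { Algebra.adjoin ℝ (Set.range e) with
      star_mem' := fun {a} ha => by
        have : star a = a := by ext x; simp
        rw [this]; exact ha }
  -- Closure under products makes the generated algebra the linear span of the exponentials, so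
  -- linearity of the integral is enough below.
  have hclosure : ∀ g ∈ Submonoid.closure (Set.range e), g ∈ Set.range e := fun g hg => by
    induction hg using Submonoid.closure_induction with
    | mem x hx => exact hx
    | one => exact ⟨0, by ext x; simp [he]⟩
    | mul x y _ _ hx hy =>
      obtain ⟨n, rfl⟩ := hx
      obtain ⟨m, rfl⟩ := hy
      refine ⟨n + m, ?_⟩
      ext x
      rw [BoundedContinuousFunction.mul_apply, he, he, he, ← ENNReal.toReal_mul, ← expNeg_add,
        ← Finset.sum_add_distrib]
      simp [add_mul]
  refine ext_of_forall_mem_subalgebra_integral_eq_of_polish (𝕜 := ℝ) (A := A) ?_ ?_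
  · intro x y hxy
    obtain ⟨i, hi⟩ := Function.ne_iff.1 hxy
    refine ⟨_, ⟨_, ⟨e (Pi.single i 1), Algebra.subset_adjoin ⟨_, rfl⟩, rfl⟩, rfl⟩, ?_⟩
    change (expNeg (∑ j, (Pi.single i 1 : ι → ℕ) j * x j)).toReal ≠
      (expNeg (∑ j, (Pi.single i 1 : ι → ℕ) j * y j)).toReal
    rw [Ne, ENNReal.toReal_eq_toReal_iff' (expNeg_ne_top _) (expNeg_ne_top _)]
    intro hxy
    apply hi
    simpa [Pi.single_apply] using expNeg_injective hxy
  · intro g hg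
    change g ∈ Algebra.adjoin ℝ (Set.range e) at hg
    rw [← Subalgebra.mem_toSubmodule, Algebra.adjoin_eq_span] at hg
    induction hg using Submodule.span_induction with
    | mem x hx =>
      obtain ⟨n, rfl⟩ := hclosure x hx
      simp_rw [he]
      rw [integral_toReal (hc n).measurable.aemeasurable (ae_of_all _ fun x =>
        (expNeg_ne_top _).lt_top), integral_toReal (hc n).measurable.aemeasurable
        (ae_of_all _ fun x => (expNeg_ne_top _).lt_top), h]
    | zero => simp
    | add x y _ _ hx hy =>
      simp only [BoundedContinuousFunction.coe_add, Pi.add_apply]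
      rw [integral_add (x.integrable _) (y.integrable _),
        integral_add (x.integrable _) (y.integrable _), hx, hy]
    | smul a x _ hx =>
      simp only [BoundedContinuousFunction.coe_smul]
      rw [integral_smul, integral_smul, hx]

lemma lintegral_pi_prod {ι : Type*} [Fintype ι] {X : ι → Type*} [∀ i, MeasurableSpace (X i)]
    (μ : ∀ i, Measure (X i)) [∀ i, IsProbabilityMeasure (μ i)] {g : ∀ i, X i → ℝ≥0∞}
    (hg : ∀ i, Measurable (g i)) :
    ∫⁻ x, ∏ i, g i (x i) ∂Measure.pi μ = ∏ i, ∫⁻ t, g i t ∂μ i := by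
  refine (lintegral_prod_eq_prod_lintegral_of_indepFun Finset.univ
    (fun i (x : ∀ i, X i) => g i (x i)) (iIndepFun_pi fun i => (hg i).aemeasurable)
    fun i => (hg i).comp (measurable_pi_apply i)).trans ?_
  refine Finset.prod_congr rfl fun i _ => ?_
  rw [← (measurePreserving_eval μ i).map_eq, lintegral_map (hg i) (measurable_pi_apply i)]

/-! ### Laplace functionals characterise Poisson processes -/

section LaplaceFunctional

variable {Ω E : Type*} [MeasurableSpace Ω] [MeasurableSpace E] {P : Measure Ω}
  {N : Ω → Measure E} {Λ : Measure E}

/-- The level sets are disjoint, so their counts are independent Poisson variables and the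
expectation factorises. -/
lemma IsPoissonProcess.lintegral_expNeg_simpleFunc [IsProbabilityMeasure P]
    (h : IsPoissonProcess P N Λ) (g : SimpleFunc E ℝ≥0∞) :
    ∫⁻ ω, expNeg (∫⁻ x, g x ∂N ω) ∂P = expNeg (∫⁻ x, (1 - expNeg (g x)) ∂Λ) := by
  classical
  let σ := g.range.equivFin
  have hmeas : ∀ B : Set E, MeasurableSet B → Measurable fun ω => N ω B := fun B hB =>
    (Measure.measurable_coe hB).comp h.measurable
  have hB : ∀ k, MeasurableSet (g ⁻¹' {(σ.symm k : ℝ≥0∞)}) := fun k => g.measurableSet_fiber _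
  have hind := h.indep g.range.card (fun k => g ⁻¹' {(σ.symm k : ℝ≥0∞)}) hB fun j k hjk => by
    refine Disjoint.preimage _ ?_
    simpa using fun hh => hjk (σ.symm.injective (Subtype.ext hh))
  have hind' : iIndepFun (fun k ω => expNeg ((σ.symm k : ℝ≥0∞) * N ω (g ⁻¹' {(σ.symm k : ℝ≥0∞)})))
      P :=
    hind.comp (fun k t => expNeg ((σ.symm k : ℝ≥0∞) * t)) fun k => by fun_prop
  have hsum : ∀ F : ℝ≥0∞ → ℝ≥0∞, ∑ c ∈ g.range, F c = ∑ k, F (σ.symm k) := fun F => by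
    rw [← Finset.sum_coe_sort, ← σ.symm.sum_comp]
  have h1 : ∀ ω, expNeg (∫⁻ x, g x ∂N ω) =
      ∏ k, expNeg ((σ.symm k : ℝ≥0∞) * N ω (g ⁻¹' {(σ.symm k : ℝ≥0∞)})) := fun ω => by
    rw [show ∫⁻ x, g x ∂N ω = g.lintegral (N ω) from g.lintegral_eq_lintegral _,
      SimpleFunc.lintegral,
      hsum fun c => c * N ω (g ⁻¹' {c}), expNeg_sum]
  have h2 : ∫⁻ x, (1 - expNeg (g x)) ∂Λ =
      ∑ k, (1 - expNeg (σ.symm k : ℝ≥0∞)) * Λ (g ⁻¹' {(σ.symm k : ℝ≥0∞)}) := by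
    have := g.map_lintegral (fun c => 1 - expNeg c) (μ := Λ)
    rw [hsum fun c => (1 - expNeg c) * Λ (g ⁻¹' {c})] at this
    exact ((g.map fun c => 1 - expNeg c).lintegral_eq_lintegral Λ).trans this
  simp_rw [h1]
  rw [lintegral_prod_eq_prod_lintegral_of_indepFun _ _ hind' fun k => by
    have := hmeas _ (hB k); fun_prop, h2, expNeg_sum]
  refine Finset.prod_congr rfl fun k _ => ?_
  rw [← lintegral_expNeg_poissonLaw, ← (h.hasLaw _ (hB k)).map_eq,
    lintegral_map (by fun_prop) (hmeas _ (hB k))]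

/-- The Laplace functional of a Poisson process. -/
lemma IsPoissonProcess.lintegral_expNeg [IsProbabilityMeasure P] (h : IsPoissonProcess P N Λ)
    {g : E → ℝ≥0∞} (hg : Measurable g) :
    ∫⁻ ω, expNeg (∫⁻ x, g x ∂N ω) ∂P = expNeg (∫⁻ x, (1 - expNeg (g x)) ∂Λ) := by
  have hlim : ∀ x, Filter.Tendsto (fun n => SimpleFunc.eapprox g n x) Filter.atTop
      (nhds (g x)) := fun x => SimpleFunc.tendsto_eapprox hg x
  have hmono : ∀ x, Monotone fun n => SimpleFunc.eapprox g n x := fun x m n hmn =>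
    SimpleFunc.monotone_eapprox g hmn x
  have hanti : Antitone expNeg := fun a b hab => by
    simpa [expNeg] using hab
  have h1 : ∀ ω, Filter.Tendsto (fun n => expNeg (∫⁻ x, SimpleFunc.eapprox g n x ∂N ω))
      Filter.atTop (nhds (expNeg (∫⁻ x, g x ∂N ω))) := fun ω =>
    (continuous_expNeg.tendsto _).comp <| lintegral_tendsto_of_tendsto_of_monotone
      (fun n => (SimpleFunc.measurable _).aemeasurable) (ae_of_all _ hmono) (ae_of_all _ hlim)
  have h2 : Filter.Tendsto (fun n => ∫⁻ ω, expNeg (∫⁻ x, SimpleFunc.eapprox g n x ∂N ω) ∂P)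
      Filter.atTop (nhds (∫⁻ ω, expNeg (∫⁻ x, g x ∂N ω) ∂P)) := by
    refine tendsto_lintegral_of_dominated_convergence (fun _ => 1) (fun n => ?_)
      (fun n => ae_of_all _ fun ω => expNeg_le_one _) (by simp) (ae_of_all _ h1)
    exact measurable_expNeg.comp
      ((Measure.measurable_lintegral (SimpleFunc.measurable _)).comp h.measurable)
  -- `Λ` may be infinite, so monotone convergence replaces domination here.
  have h3 : Filter.Tendsto (fun n => expNeg (∫⁻ x, (1 - expNeg (SimpleFunc.eapprox g n x)) ∂Λ))
      Filter.atTop (nhds (expNeg (∫⁻ x, (1 - expNeg (g x)) ∂Λ))) := by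
    refine (continuous_expNeg.tendsto _).comp <| lintegral_tendsto_of_tendsto_of_monotone
      (fun n => ?_) (ae_of_all _ fun x m n hmn => ?_) (ae_of_all _ fun x => ?_)
    · have := (SimpleFunc.eapprox g n).measurable
      fun_prop
    · exact tsub_le_tsub_left (hanti (hmono x hmn)) 1
    · exact ENNReal.Tendsto.sub tendsto_const_nhds ((continuous_expNeg.tendsto _).comp (hlim x))
        (Or.inl one_ne_top)
  simp_rw [h.lintegral_expNeg_simpleFunc] at h2
  exact tendsto_nhds_unique h2 h3

/-- A random measure with the Laplace functional of a Poisson process is a Poisson process. -/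
lemma IsPoissonProcess.of_lintegral_expNeg [IsProbabilityMeasure P] (hN : Measurable N)
    (h : ∀ g : E → ℝ≥0∞, Measurable g →
      ∫⁻ ω, expNeg (∫⁻ x, g x ∂N ω) ∂P = expNeg (∫⁻ x, (1 - expNeg (g x)) ∂Λ)) :
    IsPoissonProcess P N Λ := by
  classical
  have hmeas : ∀ B : Set E, MeasurableSet B → Measurable fun ω => N ω B := fun B hB =>
    (Measure.measurable_coe hB).comp hN
  have hjoint : ∀ (n : ℕ) (B : Fin n → Set E), (∀ k, MeasurableSet (B k)) →
      Pairwise (fun j k => Disjoint (B j) (B k)) →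
      P.map (fun ω k => N ω (B k)) = Measure.pi fun k => poissonLaw (Λ (B k)) := by
    intro n B hB hdisj
    have hm : Measurable fun ω k => N ω (B k) := measurable_pi_lambda _ fun k => hmeas _ (hB k)
    have : IsProbabilityMeasure (P.map fun ω k => N ω (B k)) :=
      Measure.isProbabilityMeasure_map hm.aemeasurable
    refine ext_of_lintegral_expNeg fun c => ?_
    have hgm : Measurable fun x => ∑ k, (B k).indicator (fun _ => (c k : ℝ≥0∞)) x :=
      Finset.measurable_sum _ fun k _ => measurable_const.indicator (hB k)
    have h1 : ∀ ω, ∫⁻ x, ∑ k, (B k).indicator (fun _ => (c k : ℝ≥0∞)) x ∂N ω =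
        ∑ k, c k * N ω (B k) := fun ω => by
      rw [lintegral_finsetSum _ fun k _ => measurable_const.indicator (hB k)]
      exact Finset.sum_congr rfl fun k _ => by rw [lintegral_indicator_const (hB k)]
    -- By disjointness at most one summand is nonzero, so `1 - expNeg` passes through the sum.
    have h2 : ∀ x, 1 - expNeg (∑ k, (B k).indicator (fun _ => (c k : ℝ≥0∞)) x) =
        ∑ k, (B k).indicator (fun _ => 1 - expNeg (c k : ℝ≥0∞)) x := fun x => by
      by_cases hx : ∃ k, x ∈ B k
      · obtain ⟨k, hk⟩ := hx
        have hne : ∀ j ≠ k, x ∉ B j := fun j hj hxj =>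
          Set.disjoint_left.1 (hdisj hj) hxj hk
        rw [Finset.sum_eq_single k (fun j _ hj => by simp [hne j hj]) (by simp),
          Finset.sum_eq_single k (fun j _ hj => by simp [hne j hj]) (by simp)]
        simp [hk]
      · push Not at hx
        simp [hx]
    rw [lintegral_map (by fun_prop) hm]
    simp_rw [← h1]
    rw [h _ hgm]
    simp_rw [h2, expNeg_sum]
    rw [lintegral_finsetSum _ fun k _ => measurable_const.indicator (hB k),
      lintegral_pi_prod (fun k => poissonLaw (Λ (B k))) (g := fun k t => expNeg (c k * t))
        fun k => by fun_prop, expNeg_sum]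
    refine Finset.prod_congr rfl fun k _ => ?_
    rw [lintegral_expNeg_poissonLaw, lintegral_indicator_const (hB k)]
  have hlaw : ∀ B : Set E, MeasurableSet B → HasLaw (fun ω => N ω B) (poissonLaw (Λ B)) P :=
    fun B hB => ⟨(hmeas B hB).aemeasurable, by
      have h1 := hjoint 1 (fun _ => B) (fun _ => hB)
        fun j k hjk => (hjk (Subsingleton.elim _ _)).elim
      have h2 := congrArg (Measure.map (fun x : Fin 1 → ℝ≥0∞ => x 0)) h1
      rw [Measure.map_map (measurable_pi_apply 0)
        (measurable_pi_lambda _ fun k => hmeas _ hB)] at h2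
      exact h2.trans (measurePreserving_eval (fun _ : Fin 1 => poissonLaw (Λ B)) 0).map_eq⟩
  refine ⟨hN, hlaw, fun n B hB hdisj => ?_⟩
  rw [iIndepFun_iff_map_fun_eq_pi_map fun k => (hmeas _ (hB k)).aemeasurable, hjoint n B hB hdisj]
  congr 1
  funext k
  exact (hlaw _ (hB k)).map_eq.symm

lemma IsPoissonProcess.lintegral_apply (h : IsPoissonProcess P N Λ) {B : Set E}
    (hB : MeasurableSet B) : ∫⁻ ω, N ω B ∂P = Λ B := by
  have := h.hasLaw B hB
  rw [← lintegral_id_poissonLaw (Λ B), ← this.map_eq,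
    lintegral_map' aemeasurable_id' this.aemeasurable]

end LaplaceFunctional

/-! ### Restriction, mapping and marking of Poisson processes -/

section Marking

variable {Ω E F : Type*} [MeasurableSpace E] [MeasurableSpace F]

lemma pointProcess_apply (x : ℕ → Ω → E) (ω : Ω) {B : Set E} (hB : MeasurableSet B) :
    pointProcess x ω B = ∑' i, B.indicator 1 (x i ω) := by
  rw [pointProcess, Measure.sum_apply _ hB]
  exact tsum_congr fun i => Measure.dirac_apply' _ hB

lemma lintegral_pointProcess (x : ℕ → Ω → E) (ω : Ω) {g : E → ℝ≥0∞} (hg : Measurable g) :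
    ∫⁻ z, g z ∂(pointProcess x ω) = ∑' i, g (x i ω) := by
  rw [pointProcess, lintegral_sum_measure]
  exact tsum_congr fun i => lintegral_dirac' _ hg

lemma map_pointProcess (x : ℕ → Ω → E) {φ : E → F} (hφ : Measurable φ) (ω : Ω) :
    (pointProcess x ω).map φ = pointProcess (fun i ω => φ (x i ω)) ω := by
  ext B hB
  rw [Measure.map_apply hφ hB, pointProcess_apply _ _ (hφ hB), pointProcess_apply _ _ hB]
  rfl

variable [MeasurableSpace Ω] {P : Measure Ω} {N : Ω → Measure E} {Λ : Measure E}

lemma measurable_pointProcess {x : ℕ → Ω → E} (hx : ∀ i, Measurable (x i)) :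
    Measurable (pointProcess x) := by
  refine Measure.measurable_of_measurable_coe _ fun B hB => ?_
  simp_rw [pointProcess_apply _ _ hB]
  exact Measurable.tsum fun i => (measurable_one.indicator hB).comp (hx i)

lemma IsPoissonProcess.restrict (h : IsPoissonProcess P N Λ) {C : Set E} (hC : MeasurableSet C) :
    IsPoissonProcess P (fun ω => (N ω).restrict C) (Λ.restrict C) where
  measurable := by
    refine Measure.measurable_of_measurable_coe _ fun B hB => ?_
    simp_rw [Measure.restrict_apply hB]
    exact (Measure.measurable_coe (hB.inter hC)).comp h.measurable
  hasLaw B hB := by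
    simp_rw [Measure.restrict_apply hB]
    exact h.hasLaw _ (hB.inter hC)
  indep n B hB hdisj := by
    have : (fun k ω => (N ω).restrict C (B k)) = fun k ω => N ω (B k ∩ C) := by
      ext k ω
      exact Measure.restrict_apply (hB k)
    rw [this]
    exact h.indep n (fun k => B k ∩ C) (fun k => (hB k).inter hC) fun j k hjk =>
      (hdisj hjk).mono Set.inter_subset_left Set.inter_subset_left

lemma IsPoissonProcess.map (h : IsPoissonProcess P N Λ) {φ : E → F} (hφ : Measurable φ) :
    IsPoissonProcess P (fun ω => (N ω).map φ) (Λ.map φ) where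
  measurable := (Measure.measurable_map φ hφ).comp h.measurable
  hasLaw B hB := by
    simp_rw [Measure.map_apply hφ hB]
    exact h.hasLaw _ (hφ hB)
  indep n B hB hdisj := by
    have : (fun k ω => (N ω).map φ (B k)) = fun k ω => N ω (φ ⁻¹' B k) := by
      ext k ω
      exact Measure.map_apply hφ (hB k)
    rw [this]
    exact h.indep n (fun k => φ ⁻¹' B k) (fun k => hφ (hB k)) fun j k hjk =>
      (hdisj hjk).preimage φ

/-- The marking theorem: attaching independent marks with distribution `ν` to the points of a
Poisson process with intensity `Λ` gives a Poisson process with intensity `Λ × ν`. -/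
theorem IsPoissonProcess.marking [IsProbabilityMeasure P] {x : ℕ → Ω → E} {f : ℕ → Ω → F}
    {ν : Measure F} [IsProbabilityMeasure ν] (h : IsPoissonProcess P (pointProcess x) Λ)
    (hx : ∀ i, Measurable (x i)) (hf : ∀ i, Measurable (f i)) (hlaw : ∀ i, HasLaw (f i) ν P)
    (hind : iIndepFun f P) (hindx : IndepFun (fun ω i => x i ω) (fun ω i => f i ω) P) :
    IsPoissonProcess P (pointProcess fun i ω => (x i ω, f i ω)) (Λ.prod ν) := by
  refine .of_lintegral_expNeg (measurable_pointProcess fun i => (hx i).prodMk (hf i))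
    fun g hg => ?_
  have hX : Measurable fun ω i => x i ω := measurable_pi_lambda _ hx
  have hF : Measurable fun ω i => f i ω := measurable_pi_lambda _ hf
  obtain ⟨u, hu⟩ : ∃ u : E → ℝ≥0∞, ∀ z, u z = ∫⁻ t, expNeg (g (z, t)) ∂ν := ⟨_, fun _ => rfl⟩
  have hum : Measurable u := by
    rw [funext hu]
    exact Measurable.lintegral_prod_right' (measurable_expNeg.comp hg)
  have hu1 : ∀ z, u z ≤ 1 := fun z => by
    rw [hu]
    exact (lintegral_mono fun t => expNeg_le_one _).trans (by simp)
  -- With the locations frozen, independence of the marks factorises the expectation.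
  have hmarks : ∀ (n : ℕ) (z : ℕ → E),
      ∫⁻ ω, ∏ i ∈ Finset.range n, expNeg (g (z i, f i ω)) ∂P = ∏ i ∈ Finset.range n, u (z i) := by
    intro n z
    have hm : ∀ i, Measurable fun t => expNeg (g (z i, t)) := fun i =>
      measurable_expNeg.comp (hg.comp measurable_prodMk_left)
    refine (lintegral_prod_eq_prod_lintegral_of_indepFun _
      (fun i ω => expNeg (g (z i, f i ω))) (hind.comp _ hm) fun i => (hm i).comp (hf i)).trans ?_
    refine Finset.prod_congr rfl fun i _ => ?_
    rw [hu, ← (hlaw i).map_eq, lintegral_map (hm i) (hf i)]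
  -- Independence of the node and mark sequences lets Fubini freeze the nodes.
  have hfin : ∀ n : ℕ, ∫⁻ ω, ∏ i ∈ Finset.range n, expNeg (g (x i ω, f i ω)) ∂P =
      ∫⁻ ω, ∏ i ∈ Finset.range n, u (x i ω) ∂P := by
    intro n
    have hG : Measurable fun p : (ℕ → E) × (ℕ → F) =>
        ∏ i ∈ Finset.range n, expNeg (g (p.1 i, p.2 i)) := by fun_prop
    rw [← lintegral_map (g := fun ω => ((fun i => x i ω), fun i => f i ω)) hG (hX.prodMk hF),
      (indepFun_iff_map_prod_eq_prod_map_map hX.aemeasurable hF.aemeasurable).1 hindx,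
      lintegral_prod _ hG.aemeasurable,
      lintegral_map hG.lintegral_prod_right' hX]
    refine lintegral_congr fun ω => ?_
    refine (lintegral_map (hG.comp measurable_prodMk_left) hF).trans ?_
    exact hmarks n fun i => x i ω
  have hlim : ∀ v : ℕ → Ω → ℝ≥0∞, (∀ i, Measurable (v i)) →
      Filter.Tendsto (fun n => ∫⁻ ω, ∏ i ∈ Finset.range n, expNeg (v i ω) ∂P) Filter.atTop
        (nhds (∫⁻ ω, expNeg (∑' i, v i ω) ∂P)) := fun v hv =>
    tendsto_lintegral_of_dominated_convergence (fun _ => 1) (fun n => by fun_prop)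
      (fun n => ae_of_all _ fun ω => Finset.prod_le_one' fun i _ => expNeg_le_one _)
      (by simp) (ae_of_all _ fun ω => expNeg_tsum_tendsto fun i => v i ω)
  have hl1 := hlim (fun i ω => g (x i ω, f i ω)) fun i => hg.comp ((hx i).prodMk (hf i))
  -- Since `u ≤ 1`, `negLog` turns `∏ u` into an exponential of a sum; `u = 0` corresponds to the
  -- value `∞`.
  have hl2 := hlim (fun i ω => negLog (u (x i ω))) fun i => measurable_negLog.comp
    (hum.comp (hx i))
  simp_rw [expNeg_negLog (hu1 _), ← hfin] at hl2
  simp_rw [lintegral_pointProcess _ _ hg]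
  have hul := h.lintegral_expNeg (measurable_negLog.comp hum)
  simp_rw [lintegral_pointProcess _ _ (measurable_negLog.comp hum), Function.comp_apply,
    expNeg_negLog (hu1 _)] at hul
  rw [tendsto_nhds_unique hl1 hl2, hul, lintegral_prod _ (by fun_prop)]
  congr 1
  refine lintegral_congr fun z => ?_
  rw [hu, lintegral_sub (by fun_prop) (((hu z ▸ hu1 z).trans_lt one_lt_top).ne)
    (ae_of_all _ fun t => expNeg_le_one _)]
  simp

end Marking

/-! ### Path losses of Lebesgue measure -/

section Geometry

variable {d : ℕ} {α : ℝ}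

lemma unitBallVolume_pos (d : ℕ) : 0 < unitBallVolume d := by
  unfold unitBallVolume
  have : 0 < Real.Gamma (1 + (d : ℝ) / 2) := Real.Gamma_pos_of_pos (by positivity)
  positivity

lemma measurable_norm_rpow (d : ℕ) (α : ℝ) :
    Measurable fun z : EuclideanSpace ℝ (Fin d) => ‖z‖ ^ α := by fun_prop

lemma volume_norm_rpow_lt (hd : 1 ≤ d) (hα : 0 < α) {a : ℝ} (ha : 0 ≤ a) :
    volume {z : EuclideanSpace ℝ (Fin d) | ‖z‖ ^ α < a} =
      ENNReal.ofReal (unitBallVolume d * a ^ ((d : ℝ) / α)) := by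
  have : Nonempty (Fin d) := ⟨⟨0, hd⟩⟩
  have hset : {z : EuclideanSpace ℝ (Fin d) | ‖z‖ ^ α < a} = Metric.ball 0 (a ^ (1 / α)) := by
    ext z
    rw [Set.mem_ofPred_eq, mem_ball_zero_iff, one_div,
      Real.lt_rpow_inv_iff_of_pos (norm_nonneg z) ha hα]
  rw [hset, EuclideanSpace.volume_ball, Fintype.card_fin, ← ENNReal.ofReal_pow (by positivity),
    ← ENNReal.ofReal_mul (by positivity), ← Real.rpow_natCast, ← Real.rpow_mul ha, mul_comm,
    unitBallVolume, Real.sqrt_eq_rpow, ← Real.rpow_natCast, ← Real.rpow_mul Real.pi_pos.le,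
    add_comm (1 : ℝ)]
  congr 3
  · ring_nf
  · ring

lemma measurable_pathLossDensity (d : ℕ) (α : ℝ) : Measurable (pathLossDensity d α) := by
  unfold pathLossDensity
  exact Measurable.ite measurableSet_Ioi (by fun_prop) measurable_const

lemma setLIntegral_pathLossDensity_Iio (hd : 1 ≤ d) (hα : 0 < α) {a : ℝ} (ha : 0 ≤ a) :
    ∫⁻ x in Set.Iio a, pathLossDensity d α x =
      ENNReal.ofReal (unitBallVolume d * a ^ ((d : ℝ) / α)) := by
  have hδ : 0 < (d : ℝ) / α := div_pos (by exact_mod_cast hd) hα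
  have hc := unitBallVolume_pos d
  have hr : (-1 : ℝ) < (d : ℝ) / α - 1 := by linarith
  have hind : pathLossDensity d α = (Set.Ioi 0).indicator fun x =>
      ENNReal.ofReal (unitBallVolume d * (d / α) * x ^ ((d : ℝ) / α - 1)) := rfl
  have hint := (intervalIntegral.intervalIntegrable_rpow' (a := 0) (b := a) hr).const_mul
    (unitBallVolume d * (d / α))
  rw [hind, lintegral_indicator measurableSet_Ioi, Measure.restrict_restrict measurableSet_Ioi,
    Set.Ioi_inter_Iio, setLIntegral_congr Ioo_ae_eq_Ioc, ← ofReal_integral_eq_lintegral_ofReal,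
    ← intervalIntegral.integral_of_le ha, intervalIntegral.integral_const_mul,
    integral_rpow (Or.inl hr)]
  · simp only [sub_add_cancel, Real.zero_rpow hδ.ne', sub_zero]
    congr 1
    field_simp
  · exact (intervalIntegrable_iff_integrableOn_Ioc_of_le ha).1 hint
  · refine (ae_restrict_iff' measurableSet_Ioc).2 (ae_of_all _ fun x hx => ?_)
    have := hx.1
    simp only [Pi.zero_apply]
    positivity

/-- The path losses of the points of Lebesgue measure have density `pathLossDensity`. -/
lemma map_norm_rpow_volume (hd : 1 ≤ d) (hα : 0 < α) :
    (volume : Measure (EuclideanSpace ℝ (Fin d))).map (fun z => ‖z‖ ^ α) =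
      volume.withDensity (pathLossDensity d α) := by
  have hneg : ∀ a : ℝ, a ≤ 0 →
      (volume : Measure (EuclideanSpace ℝ (Fin d))).map (fun z => ‖z‖ ^ α) (Set.Iio a) = 0 ∧
      volume.withDensity (pathLossDensity d α) (Set.Iio a) = 0 := fun a ha => by
    constructor
    · rw [Measure.map_apply (measurable_norm_rpow d α) measurableSet_Iio]
      convert measure_empty (μ := volume)
      ext z
      have : 0 ≤ ‖z‖ ^ α := by positivity
      simpa using ha.trans this
    · rw [withDensity_apply _ measurableSet_Iio, setLIntegral_congr_fun measurableSet_Iio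
        (g := fun _ => 0), lintegral_zero]
      intro x hx
      exact if_neg (not_lt.2 (le_of_lt (lt_of_lt_of_le hx ha)))
  have hpos : ∀ a : ℝ, 0 ≤ a →
      (volume : Measure (EuclideanSpace ℝ (Fin d))).map (fun z => ‖z‖ ^ α) (Set.Iio a) =
        ENNReal.ofReal (unitBallVolume d * a ^ ((d : ℝ) / α)) := fun a ha => by
    rw [Measure.map_apply (measurable_norm_rpow d α) measurableSet_Iio]
    exact volume_norm_rpow_lt hd hα ha
  -- Half-lines form a generating π-system, and the sets `Iio n` exhaust the line with finite mass.
  refine Measure.ext_of_generateFrom_of_iUnion (Set.range Set.Iio) (fun n : ℕ => Set.Iio (n : ℝ))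
    (borel_eq_generateFrom_Iio ℝ ▸ BorelSpace.measurable_eq) isPiSystem_Iio ?_
    (fun n => ⟨n, rfl⟩) (fun n => ?_) ?_
  · exact Set.eq_univ_of_forall fun x => Set.mem_iUnion.2 (exists_nat_gt x)
  · rw [hpos n n.cast_nonneg]
    exact ENNReal.ofReal_ne_top
  · rintro _ ⟨a, rfl⟩
    rcases le_total a 0 with ha | ha
    · rw [(hneg a ha).1, (hneg a ha).2]
    · rw [hpos a ha, withDensity_apply _ measurableSet_Iio,
        setLIntegral_pathLossDensity_Iio hd hα ha]

end Geometry

/-! ### The connected region and its fibres -/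

section Connectivity

variable {d : ℕ} {α s : ℝ}

/-- The pairs of a location and a fading coefficient for which a node is connected. -/
def connectedRegion (d : ℕ) (α s : ℝ) : Set (EuclideanSpace ℝ (Fin d) × ℝ) :=
  {p | ENNReal.ofReal (‖p.1‖ ^ α) / ENNReal.ofReal p.2 < ENNReal.ofReal (1 / s)}

lemma measurableSet_connectedRegion (d : ℕ) (α s : ℝ) :
    MeasurableSet (connectedRegion d α s) :=
  measurableSet_lt (by fun_prop) measurable_const

lemma ofReal_div_ofReal_lt_iff {x t : ℝ} (hs : 0 < s) (ht : 0 < t) :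
    ENNReal.ofReal x / ENNReal.ofReal t < ENNReal.ofReal (1 / s) ↔ x < t / s := by
  rw [← ENNReal.ofReal_div_of_pos ht, ENNReal.ofReal_lt_ofReal_iff (by positivity),
    div_lt_iff₀ ht, one_div_mul_eq_div]

/-- For `t ≤ 0` the quotient is `∞`. Positivity of `x` excludes `0 / 0 = 0`, for which the
equivalence fails. -/
lemma ofReal_div_ofReal_lt_iff_of_pos {x t : ℝ} (hs : 0 < s) (hx : 0 < x) :
    ENNReal.ofReal x / ENNReal.ofReal t < ENNReal.ofReal (1 / s) ↔ s * x < t := by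
  rcases le_or_gt t 0 with ht | ht
  · have h1 : ENNReal.ofReal x ≠ 0 := (ENNReal.ofReal_pos.2 hx).ne'
    rw [ENNReal.ofReal_of_nonpos ht, ENNReal.div_zero h1]
    simpa using ht.trans (by positivity)
  · rw [ofReal_div_ofReal_lt_iff hs ht, lt_div_iff₀ hs, mul_comm]

lemma ofReal_one_sub_cdf (ν : Measure ℝ) [IsProbabilityMeasure ν] (a : ℝ) :
    ENNReal.ofReal (1 - cdf ν a) = ν (Set.Ioi a) := by
  rw [ENNReal.ofReal_sub _ (cdf_nonneg ν a), ENNReal.ofReal_one, ofReal_cdf,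
    ← prob_compl_eq_one_sub measurableSet_Iic, Set.compl_Iic]

lemma measurable_ofReal_one_sub_cdf (ν : Measure ℝ) (s : ℝ) :
    Measurable fun x : ℝ => ENNReal.ofReal (1 - cdf ν (s * x)) := by
  have : Measurable (cdf ν) := (monotone_cdf ν).measurable
  fun_prop

lemma map_restrict_connectedRegion (hd : 1 ≤ d) (hα : 0 < α) (hs : 0 < s) (ν : Measure ℝ)
    [IsProbabilityMeasure ν] :
    ((volume.prod ν).restrict (connectedRegion d α s)).map (fun p => ‖p.1‖ ^ α) =
      volume.withDensity fun x =>
        pathLossDensity d α x * ENNReal.ofReal (1 - cdf ν (s * x)) := by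
  have : Nonempty (Fin d) := ⟨⟨0, hd⟩⟩
  have hm := measurable_norm_rpow d α
  have hF := measurable_ofReal_one_sub_cdf ν s
  have hφ : Measurable fun p : EuclideanSpace ℝ (Fin d) × ℝ => ‖p.1‖ ^ α := hm.comp measurable_fst
  have hC := measurableSet_connectedRegion d α s
  change _ = volume.withDensity (pathLossDensity d α * fun x => ENNReal.ofReal (1 - cdf ν (s * x)))
  rw [withDensity_mul _ (measurable_pathLossDensity d α) hF, ← map_norm_rpow_volume hd hα]
  ext B hB
  rw [Measure.map_apply hφ hB, Measure.restrict_apply (hφ hB), Measure.prod_apply ((hφ hB).inter hC),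
    withDensity_apply _ hB, setLIntegral_map hB hF hm, ← lintegral_indicator (hm hB)]
  -- The origin, where the fibre description can fail, is a null set since `d ≥ 1`.
  have h0 : ∀ᵐ z : EuclideanSpace ℝ (Fin d), z ≠ 0 := by simp [ae_iff]
  refine lintegral_congr_ae (h0.mono fun z hz => ?_)
  have hz' : 0 < ‖z‖ ^ α := Real.rpow_pos_of_pos (norm_pos_iff.2 hz) α
  by_cases hzB : ‖z‖ ^ α ∈ B
  · rw [Set.indicator_of_mem (show z ∈ (fun z => ‖z‖ ^ α) ⁻¹' B from hzB), ofReal_one_sub_cdf]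
    refine congrArg ν (Set.ext fun t => ?_)
    exact (and_iff_right hzB).trans (ofReal_div_ofReal_lt_iff_of_pos hs hz')
  · rw [Set.indicator_of_notMem (show z ∉ (fun z => ‖z‖ ^ α) ⁻¹' B from hzB)]
    convert measure_empty (μ := ν)
    ext t
    simp [hzB]

lemma volume_connectedRegion_section (hd : 1 ≤ d) (hα : 0 < α) (hs : 0 < s) {t : ℝ} (ht : 0 < t) :
    volume ((fun z => (z, t)) ⁻¹' connectedRegion d α s) =
      ENNReal.ofReal (unitBallVolume d / s ^ ((d : ℝ) / α)) *
        ENNReal.ofReal (t ^ ((d : ℝ) / α)) := by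
  have hc := unitBallVolume_pos d
  rw [← ENNReal.ofReal_mul (by positivity), div_mul_eq_mul_div, mul_div_assoc,
    ← Real.div_rpow ht.le hs.le, ← volume_norm_rpow_lt hd hα (by positivity)]
  congr 1
  ext z
  exact ofReal_div_ofReal_lt_iff hs ht

lemma prod_connectedRegion (hd : 1 ≤ d) (hα : 0 < α) (hs : 0 < s) {ν : Measure ℝ}
    [IsProbabilityMeasure ν] (hν : ∀ᵐ t ∂ν, 0 < t) :
    (volume.prod ν) (connectedRegion d α s) =
      ENNReal.ofReal (unitBallVolume d / s ^ ((d : ℝ) / α)) *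
        ∫⁻ t, ENNReal.ofReal (t ^ ((d : ℝ) / α)) ∂ν := by
  rw [Measure.prod_apply_symm (measurableSet_connectedRegion d α s), ← lintegral_const_mul _
    (by fun_prop)]
  exact lintegral_congr_ae (hν.mono fun t ht => volume_connectedRegion_section hd hα hs ht)

variable {Ω : Type*}

lemma connectedProcess_eq_map (y : ℕ → Ω → EuclideanSpace ℝ (Fin d)) (f : ℕ → Ω → ℝ) (ω : Ω) :
    connectedProcess α s y f ω =
      ((pointProcess (fun i ω => (y i ω, f i ω)) ω).restrict (connectedRegion d α s)).map
        fun p => ‖p.1‖ ^ α := by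
  have hφ : Measurable fun p : EuclideanSpace ℝ (Fin d) × ℝ => ‖p.1‖ ^ α :=
    (measurable_norm_rpow d α).comp measurable_fst
  ext B hB
  rw [Measure.map_apply hφ hB, Measure.restrict_apply (hφ hB),
    pointProcess_apply _ _ ((hφ hB).inter (measurableSet_connectedRegion d α s)),
    connectedProcess, Measure.sum_apply _ hB]
  simp_rw [Measure.dirac_apply' _ hB]
  refine (tsum_subtype {i | fadedPathLoss α y f i ω < ENNReal.ofReal (1 / s)}
    fun i => B.indicator 1 (pathLoss α y i ω)).trans ?_
  refine tsum_congr fun i => ?_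
  rw [Set.inter_comm, ← Set.indicator_indicator]
  rfl

lemma connectedCount_eq (y : ℕ → Ω → EuclideanSpace ℝ (Fin d)) (f : ℕ → Ω → ℝ) (ω : Ω) :
    connectedCount α s y f ω =
      pointProcess (fun i ω => (y i ω, f i ω)) ω (connectedRegion d α s) := by
  have hφ : Measurable fun p : EuclideanSpace ℝ (Fin d) × ℝ => ‖p.1‖ ^ α :=
    (measurable_norm_rpow d α).comp measurable_fst
  rw [connectedCount, connectedProcess_eq_map, Measure.map_apply hφ measurableSet_Ici,
    Measure.restrict_apply (hφ measurableSet_Ici)]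
  congr 1
  refine Set.inter_eq_right.2 fun p _ => ?_
  exact Real.rpow_nonneg (norm_nonneg p.1) α

/-- With constant fading the connected nodes are those in the fibre over `t = 1`, so the unmarked
process suffices. -/
lemma lintegral_connectedCount_one [MeasurableSpace Ω] {P : Measure Ω} (hd : 1 ≤ d) (hα : 0 < α)
    (hs : 0 < s) {y : ℕ → Ω → EuclideanSpace ℝ (Fin d)}
    (hy : IsPoissonProcess P (pointProcess y) volume) :
    ∫⁻ ω, connectedCount α s y (fun _ _ => 1) ω ∂P =
      ENNReal.ofReal (unitBallVolume d / s ^ ((d : ℝ) / α)) := by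
  have hC := measurableSet_connectedRegion d α s
  have hp : Measurable fun z : EuclideanSpace ℝ (Fin d) => (z, (1 : ℝ)) := by fun_prop
  have h1 : ∀ ω, connectedCount α s y (fun _ _ => 1) ω =
      pointProcess y ω ((fun z => (z, (1 : ℝ))) ⁻¹' connectedRegion d α s) := fun ω => by
    rw [connectedCount_eq, pointProcess_apply _ _ hC, pointProcess_apply _ _ (hp hC)]
    rfl
  simp_rw [h1]
  rw [hy.lintegral_apply (hp hC), volume_connectedRegion_section hd hα hs one_pos]
  simp

end Connectivity

/-! ### Fractional moments of the gamma law -/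

section Gamma

lemma ae_pos_gammaMeasure (m r : ℝ) : ∀ᵐ t ∂gammaMeasure m r, 0 < t := by
  have hpdf : Measurable (gammaPDF m r) := (measurable_gammaPDFReal m r).ennreal_ofReal
  rw [gammaMeasure, ae_withDensity_iff hpdf]
  have h0 : ∀ᵐ t : ℝ, t ≠ 0 := by simp [ae_iff]
  filter_upwards [h0] with t ht htp
  by_contra hneg
  exact htp (gammaPDF_of_neg (lt_of_le_of_ne (not_lt.1 hneg) ht))

/-- The factor `t ^ δ` raises the shape parameter from `m` to `δ + m`. -/
lemma lintegral_rpow_gammaMeasure {m r δ : ℝ} (hm : 0 < m) (hr : 0 < r) (hδ : 0 < δ) :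
    ∫⁻ t, ENNReal.ofReal (t ^ δ) ∂gammaMeasure m r =
      ENNReal.ofReal (1 / r ^ δ * (Real.Gamma (δ + m) / Real.Gamma m)) := by
  have hpdf : Measurable (gammaPDF m r) := (measurable_gammaPDFReal m r).ennreal_ofReal
  have hΓ := Real.Gamma_pos_of_pos hm
  have hΓ' := Real.Gamma_pos_of_pos (add_pos hδ hm)
  have hval := Real.integral_rpow_mul_exp_neg_mul_Ioi (add_pos hδ hm) hr
  -- A non-integrable function has integral `0` by convention, whereas the value in `hval` is
  -- positive.
  have hint : IntegrableOn (fun t : ℝ => t ^ (δ + m - 1) * Real.exp (-(r * t))) (Set.Ioi 0) := by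
    by_contra h
    rw [integral_undef h] at hval
    have : 0 < (1 / r) ^ (δ + m) * Real.Gamma (δ + m) := by positivity
    linarith
  have hcongr : (gammaPDF m r * fun t => ENNReal.ofReal (t ^ δ)) =ᵐ[volume]
      (Set.Ioi 0).indicator fun t => ENNReal.ofReal
        (r ^ m / Real.Gamma m * (t ^ (δ + m - 1) * Real.exp (-(r * t)))) := by
    have h0 : ∀ᵐ t : ℝ, t ≠ 0 := by simp [ae_iff]
    filter_upwards [h0] with t ht
    rcases lt_or_gt_of_ne ht with ht | ht
    · rw [Pi.mul_apply, gammaPDF_of_neg ht, zero_mul,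
        Set.indicator_of_notMem (Set.notMem_Ioi.2 ht.le)]
    · rw [Pi.mul_apply, gammaPDF_of_nonneg ht.le, Set.indicator_of_mem (Set.mem_Ioi.2 ht),
        ← ENNReal.ofReal_mul (by positivity), add_sub_assoc, Real.rpow_add ht]
      congr 1
      ring
  rw [gammaMeasure, lintegral_withDensity_eq_lintegral_mul _ hpdf (by fun_prop),
    lintegral_congr_ae hcongr, lintegral_indicator measurableSet_Ioi,
    ← ofReal_integral_eq_lintegral_ofReal (hint.const_mul _), integral_const_mul, hval]
  · rw [one_div, Real.inv_rpow hr.le, Real.rpow_add hr]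
    congr 1
    have := Real.rpow_pos_of_pos hr m
    field_simp
  · refine (ae_restrict_iff' measurableSet_Ioi).2 (ae_of_all _ fun t ht => ?_)
    have : 0 < t := ht
    simp only [Pi.zero_apply]
    positivity

end Gamma

/-! ### The fading network and the main theorem -/

section Network

variable {Ω : Type*} [MeasurableSpace Ω] {P : Measure Ω} {d : ℕ} {α s : ℝ}
  {y : ℕ → Ω → EuclideanSpace ℝ (Fin d)} {f : ℕ → Ω → ℝ} {ν : Measure ℝ}

lemma hasDensity_pointProcess_pathLoss (hd : 1 ≤ d) (hα : 0 < α)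
    (hy : IsPoissonProcess P (pointProcess y) volume) :
    HasDensity P (pointProcess (pathLoss α y)) (pathLossDensity d α) := by
  refine ⟨measurable_pathLossDensity d α, fun B hB => ?_⟩
  rw [← withDensity_apply _ hB, ← map_norm_rpow_volume hd hα,
    ← (hy.map (measurable_norm_rpow d α)).lintegral_apply hB]
  simp_rw [map_pointProcess _ (measurable_norm_rpow d α)]
  rfl

lemma HasDensity.ae_eq {N : Ω → Measure ℝ} {l l' : ℝ → ℝ≥0∞} (h : HasDensity P N l)
    (h' : HasDensity P N l') : l =ᵐ[volume] l' :=
  ae_eq_of_forall_setLIntegral_eq_of_sigmaFinite h.1 h'.1 fun B hB _ => by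
    rw [← h.2 B hB, ← h'.2 B hB]

lemma IsPoissonProcess.hasDensity {N : Ω → Measure ℝ} {l : ℝ → ℝ≥0∞}
    (h : IsPoissonProcess P N (volume.withDensity l)) (hl : Measurable l) : HasDensity P N l :=
  ⟨hl, fun B hB => by rw [h.lintegral_apply hB, withDensity_apply _ hB]⟩

variable [IsProbabilityMeasure P] [IsProbabilityMeasure ν]

lemma IsFadingNetwork.isPoissonProcess_marked (h : IsFadingNetwork P d y f ν) :
    IsPoissonProcess P (pointProcess fun i ω => (y i ω, f i ω)) (volume.prod ν) :=
  h.poisson_node.marking h.measurable_node h.measurable_fading h.law_fading h.indep_fading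
    h.indep_node_fading

lemma IsFadingNetwork.isPoissonProcess_connected (h : IsFadingNetwork P d y f ν) (hd : 1 ≤ d)
    (hα : 0 < α) (hs : 0 < s) :
    IsPoissonProcess P (connectedProcess α s y f) (volume.withDensity fun x =>
      pathLossDensity d α x * ENNReal.ofReal (1 - cdf ν (s * x))) := by
  rw [← map_restrict_connectedRegion hd hα hs, funext (connectedProcess_eq_map y f)]
  exact (h.isPoissonProcess_marked.restrict (measurableSet_connectedRegion d α s)).map
    ((measurable_norm_rpow d α).comp measurable_fst)

end Network

theorem mainTheorem1 {Ω : Type*} [MeasurableSpace Ω] (P : Measure Ω) [IsProbabilityMeasure P]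
    (d : ℕ) (hd : 1 ≤ d) (α s δ : ℝ) (hα : 0 < α) (hs : 0 < s) (hδ : δ = d / α)
    (y : ℕ → Ω → EuclideanSpace ℝ (Fin d)) (f : ℕ → Ω → ℝ) (ν : Measure ℝ)
    [IsProbabilityMeasure ν] (hnet : IsFadingNetwork P d y f ν) :
    (HasDensity P (pointProcess (pathLoss α y)) (pathLossDensity d α) ∧
      ∀ l : ℝ → ℝ≥0∞, HasDensity P (pointProcess (pathLoss α y)) l →
        IsPoissonProcess P (connectedProcess α s y f)
          (volume.withDensity fun x => l x * ENNReal.ofReal (1 - cdf ν (s * x))) ∧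
        HasDensity P (connectedProcess α s y f)
          (fun x => l x * ENNReal.ofReal (1 - cdf ν (s * x)))) ∧
    (∀ m : ℝ, 0 < m → ν = gammaMeasure m m →
      HasLaw (connectedCount α s y f)
        (poissonLaw (ENNReal.ofReal
          (unitBallVolume d / (m * s) ^ δ * (Real.Gamma (δ + m) / Real.Gamma m)))) P ∧
      ∫⁻ ω, connectedCount α s y f ω ∂P = ENNReal.ofReal
        (unitBallVolume d / (m * s) ^ δ * (Real.Gamma (δ + m) / Real.Gamma m)) ∧
      connectivityFadingGain P α s y f =
        ENNReal.ofReal (1 / m ^ δ * (Real.Gamma (δ + m) / Real.Gamma m)) ∧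
      1 / m ^ δ * (Real.Gamma (δ + m) / Real.Gamma m) = ∫ t, t ^ δ ∂ν) := by
  have hden := hasDensity_pointProcess_pathLoss hd hα hnet.poisson_node
  refine ⟨⟨hden, fun l hl => ?_⟩, fun m hm hν => ?_⟩
  -- A density is determined only almost everywhere, which `withDensity` does not detect.
  · have hpois : IsPoissonProcess P (connectedProcess α s y f)
        (volume.withDensity fun x => l x * ENNReal.ofReal (1 - cdf ν (s * x))) := by
      have hae : (fun x => l x * ENNReal.ofReal (1 - cdf ν (s * x))) =ᵐ[volume]
          fun x => pathLossDensity d α x * ENNReal.ofReal (1 - cdf ν (s * x)) :=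
        (hl.ae_eq hden).mul (ae_eq_refl _)
      rw [withDensity_congr_ae hae]
      exact hnet.isPoissonProcess_connected hd hα hs
    exact ⟨hpois, hpois.hasDensity (hl.1.mul (measurable_ofReal_one_sub_cdf ν s))⟩
  · have hδ0 : 0 < δ := hδ ▸ div_pos (by exact_mod_cast hd) hα
    have hc := unitBallVolume_pos d
    have hΓ := Real.Gamma_pos_of_pos hm
    have hΓ' := Real.Gamma_pos_of_pos (add_pos hδ0 hm)
    have hG := lintegral_rpow_gammaMeasure hm hm hδ0
    have hpos := ae_pos_gammaMeasure m m
    rw [← hν] at hG hpos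
    have hC := measurableSet_connectedRegion d α s
    have hcount : connectedCount α s y f = fun ω =>
        pointProcess (fun i ω => (y i ω, f i ω)) ω (connectedRegion d α s) :=
      funext (connectedCount_eq y f)
    -- The factor `c_d / s ^ δ` is the mean count without fading; kept separate, it cancels in the
    -- gain.
    have hmean' : (volume.prod ν) (connectedRegion d α s) =
        ENNReal.ofReal (1 / m ^ δ * (Real.Gamma (δ + m) / Real.Gamma m)) *
          ENNReal.ofReal (unitBallVolume d / s ^ δ) := by
      rw [prod_connectedRegion hd hα hs hpos, ← hδ, hG, mul_comm]
    have hmean : (volume.prod ν) (connectedRegion d α s) = ENNReal.ofReal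
        (unitBallVolume d / (m * s) ^ δ * (Real.Gamma (δ + m) / Real.Gamma m)) := by
      rw [hmean', ← ENNReal.ofReal_mul (by positivity), Real.mul_rpow hm.le hs.le]
      congr 1
      field_simp
    have hexp : ∫⁻ ω, connectedCount α s y f ω ∂P =
        (volume.prod ν) (connectedRegion d α s) := by
      rw [hcount]
      exact hnet.isPoissonProcess_marked.lintegral_apply hC
    refine ⟨?_, hexp.trans hmean, ?_, ?_⟩
    · rw [hcount, ← hmean]
      exact hnet.isPoissonProcess_marked.hasLaw _ hC
    · rw [connectivityFadingGain, hexp, lintegral_connectedCount_one hd hα hs hnet.poisson_node,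
        ← hδ, hmean', ENNReal.mul_div_cancel_right (ENNReal.ofReal_pos.2 (by positivity)).ne'
        ENNReal.ofReal_ne_top]
    · rw [integral_eq_lintegral_of_nonneg_ae (hpos.mono fun t ht => Real.rpow_nonneg ht.le δ)
        (by fun_prop), hG, ENNReal.toReal_ofReal (by positivity)]
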